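/- Let $(\Omega,\mathcal F)$ be a measurable space and let $\mathfrak P$ be a nonempty set of probability measures on it. Put $\mathbf c(A)=\sup_{\mathbb P\in\mathfrak P}\mathbb P(A)$ for $A\in\mathcal F$; an event $A$ is *polar* if $\mathbf c(A)=0$, and a property holds *quasi surely* if it holds outside a polar event. **Spaces.** $L^0_{\mathbf c}$ is the space of real-valued random variables on $(\Omega,\mathcal F)$ modulo quasi-sure equality. It is a vector lattice for the quasi-sure order $\preceq$ ($X\preceq Y$ iff $f\le g$ quasi surely for representatives $f$ of $X$ and $g$ of $Y$), with positive cone $L^0_{\mathbf c+}$. $ca_{\mathbf c}$ is the set of finite countably additive signed measures $\mu$ on $\mathcal F$ whose total variation measure $|\mu|$ vanishes on all polar events, and $ca_{\mathbf c+}$ is the set of its setwise nonnegative elements. **Supports.** A measure $\mu$ on $\mathcal F$ is *supported* if there is $S\in\mathcal F$ such that $\mu(S^c)=0$ and, for every $N\in\mathcal F$, $\mu(N\cap S)=0$ implies that $N\cap S$ is polar. Put $sca_{\mathbf c}=\{\mu\in ca_{\mathbf c} : |\mu| \text{ is supported}\}$. The set $\mathfrak P$ is *of class (S)* if there is a nonempty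 set $\mathfrak Q$ of supported probability measures on $\mathcal F$ that is equivalent to $\mathfrak P$, i.e. for all $N\in\mathcal F$: $\sup_{\mathbb Q\in\mathfrak Q}\mathbb Q(N)=0$ iff $\mathbf c(N)=0$. **Properties of sets.** A set $\mathcal C\subset L^0_{\mathbf c+}$ is *solid* if $X\in\mathcal C$ and $0\preceq Y\preceq X$ imply $Y\in\mathcal C$. A net $(X_\alpha)_{\alpha\in I}$ in $L^0_{\mathbf c}$ is *order convergent* to $X$ if there is a decreasing net $(Y_\alpha)_{\alpha\in I}$ in $L^0_{\mathbf c}$ with $\inf_\alpha Y_\alpha=0$ and $|X_\alpha-X|\preceq Y_\alpha$ for all $\alpha\in I$; a set is *order closed* if it contains the limit of every order convergent net of its elements. For $\mathcal C\subset L^0_{\mathbf c+}$ let $$\mathcal C^\diamond=\Big\{\mu\in ca_{\mathbf c+} : \int X\,d\mu\le 1 \text{ for all } X\in\mathcal C\Big\},$$ where integrals take values in $[0,\infty]$, and consider the properties - (BS1) $\mathcal C$ is order closed; - (BS2) $\mathcal C=\{X\in L^0_{\mathbf c+} : \int X\,d\mu\le 1 \text{ for all } \mu\in\mathcal C^\diamond\}$;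 - (BS3) $\mathcal C=\{X\in L^0_{\mathbf c+} : \int X\,d\mu\le 1 \text{ for all } \mu\in\mathcal C^\diamond\cap sca_{\mathbf c}\}$. **Theorem.** 1. $\mathfrak P$ is of class (S) if and only if, for every nonempty convex solid set $\mathcal C\subset L^0_{\mathbf c+}$, (BS1) and (BS3) are equivalent. 2. $sca_{\mathbf c}=ca_{\mathbf c}$ if and only if, for every nonempty convex solid set $\mathcal C\subset L^0_{\mathbf c+}$, (BS1) and (BS2) are equivalent. -/

import Mathlib

open MeasureTheory
open scoped ENNReal

universe u

namespace RobustBS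

noncomputable section

/-! ### Order convergence in vector lattices -/

/-- A net `x` indexed by a directed set `I` is order convergent to `a` if there is a decreasing
net `y` over the same index set with infimum `0` and `|x i - a| ≤ y i` for all `i`. -/
def OrderTendsto {I : Type*} [Preorder I] {E : Type*} [Lattice E] [AddCommGroup E]
    (x : I → E) (a : E) : Prop :=
  ∃ y : I → E, Antitone y ∧ IsGLB (Set.range y) 0 ∧ ∀ i, |x i - a| ≤ y i

/-- A set is order closed if it contains the limit of each order convergent net of its elements.
Index sets in the universe of `E` suffice: an order convergent net can be re-indexed by the range
of its dominating net `y`, which is a subset of `E` directed by `≥`. -/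
def IsOrderClosed {E : Type u} [Lattice E] [AddCommGroup E] (C : Set E) : Prop :=
  ∀ (I : Type u) [Preorder I] [IsDirectedOrder I] [Nonempty I] (x : I → E) (a : E),
    (∀ i, x i ∈ C) → OrderTendsto x a → a ∈ C

/-- A subset `C` of the positive cone is solid if `X ∈ C` and `0 ≤ Y ≤ X` imply `Y ∈ C`. -/
def IsSolidPos {E : Type*} [LE E] [Zero E] (C : Set E) : Prop :=
  ∀ X ∈ C, ∀ Y : E, 0 ≤ Y → Y ≤ X → Y ∈ C

variable {Ω : Type u} [MeasurableSpace Ω]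

/-! ### Quasi-sure notions -/

/-- The upper probability `c(A) = sup_{P ∈ 𝔓} P(A)`. -/
def upperProb (𝔓 : Set (Measure Ω)) (A : Set Ω) : ℝ≥0∞ := ⨆ P ∈ 𝔓, P A

/-- An event is `𝔓`-polar if its upper probability vanishes. -/
def IsPolar (𝔓 : Set (Measure Ω)) (A : Set Ω) : Prop :=
  MeasurableSet A ∧ upperProb 𝔓 A = 0

/-- `𝔖 ≪ 𝔗` : every event that is null for all elements of `𝔗` is null for all elements
of `𝔖`. -/
def DominatedBy (𝔖 𝔗 : Set (Measure Ω)) : Prop :=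
  ∀ N : Set Ω, MeasurableSet N → (⨆ ν ∈ 𝔗, ν N) = 0 → (⨆ μ ∈ 𝔖, μ N) = 0

/-- `𝔖 ≈ 𝔗`. -/
def EquivalentTo (𝔖 𝔗 : Set (Measure Ω)) : Prop :=
  DominatedBy 𝔖 𝔗 ∧ DominatedBy 𝔗 𝔖

/-- An auxiliary measure that encodes the `𝔓`-polar events: its null sets are exactly the subsets
of `𝔓`-polar events (see `qsMeasure_eq_zero_iff`), so that a property holds `𝔓`-quasi surely if and
only if it holds almost everywhere with respect to it. Only its null sets are ever used. -/
def qsMeasure (𝔓 : Set (Measure Ω)) : Measure Ω := Measure.sum (fun P : 𝔓 => (P : Measure Ω))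

theorem qsMeasure_eq_zero_iff (𝔓 : Set (Measure Ω)) (A : Set Ω) :
    qsMeasure 𝔓 A = 0 ↔ ∃ N, IsPolar 𝔓 N ∧ A ⊆ N := by
  have key : ∀ N, MeasurableSet N → (qsMeasure 𝔓 N = 0 ↔ upperProb 𝔓 N = 0) := by
    intro N hN
    simp [qsMeasure, upperProb, Measure.sum_apply _ hN]
  constructor
  · intro h
    refine ⟨toMeasurable (qsMeasure 𝔓) A, ⟨measurableSet_toMeasurable _ _, ?_⟩,
      subset_toMeasurable _ _⟩
    rw [← key _ (measurableSet_toMeasurable _ _), measure_toMeasurable, h]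
  · rintro ⟨N, ⟨hN, h0⟩, hAN⟩
    exact measure_mono_null hAN ((key N hN).2 h0)

/-- A property holds quasi surely (outside a polar event) iff it holds `qsMeasure 𝔓`-a.e. -/
theorem ae_qsMeasure_iff (𝔓 : Set (Measure Ω)) (p : Ω → Prop) :
    (∀ᵐ ω ∂(qsMeasure 𝔓), p ω) ↔ ∃ N, IsPolar 𝔓 N ∧ ∀ ω, ω ∉ N → p ω := by
  rw [ae_iff, qsMeasure_eq_zero_iff]
  constructor
  · rintro ⟨N, hN, h⟩
    exact ⟨N, hN, fun ω hω => by by_contra hp; exact hω (h hp)⟩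
  · rintro ⟨N, hN, h⟩
    exact ⟨N, hN, fun ω hω => by by_contra hn; exact hω (h ω hn)⟩

/-- `L⁰_c`: real random variables modulo `𝔓`-quasi-sure equality, with its vector space structure,
the quasi-sure order and its pointwise lattice operations. Every class has a measurable
representative. -/
abbrev L0 (𝔓 : Set (Measure Ω)) : Type u := Ω →ₘ[qsMeasure 𝔓] ℝ

/-- The order of `L0` is the quasi-sure order of representatives. -/
theorem mk_le_mk_iff (𝔓 : Set (Measure Ω)) (f g : Ω → ℝ) (hf : Measurable f) (hg : Measurable g) :
    (AEEqFun.mk f hf.aestronglyMeasurable : L0 𝔓) ≤ AEEqFun.mk g hg.aestronglyMeasurable ↔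
      ∃ N, IsPolar 𝔓 N ∧ ∀ ω, ω ∉ N → f ω ≤ g ω := by
  rw [AEEqFun.mk_le_mk]
  exact ae_qsMeasure_iff 𝔓 (fun ω => f ω ≤ g ω)

/-! ### Spaces of measures -/

/-- `ca_c`: the finite signed measures `μ ≪ 𝔓`. -/
def caC (𝔓 : Set (Measure Ω)) : Set (SignedMeasure Ω) :=
  {μ | DominatedBy {μ.totalVariation} 𝔓}

/-- The positive cone of `ca_c` for the setwise order. -/
def caCPos (𝔓 : Set (Measure Ω)) : Set (SignedMeasure Ω) := {μ ∈ caC 𝔓 | 0 ≤ μ}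

/-- A measure is supported if it has an order support `S`. -/
def IsSupported (𝔓 : Set (Measure Ω)) (μ : Measure Ω) : Prop :=
  ∃ S : Set Ω, MeasurableSet S ∧ μ Sᶜ = 0 ∧
    ∀ N : Set Ω, MeasurableSet N → μ (N ∩ S) = 0 → IsPolar 𝔓 (N ∩ S)

/-- `sca_c`: the elements of `ca_c` whose total variation measure is supported. -/
def scaC (𝔓 : Set (Measure Ω)) : Set (SignedMeasure Ω) :=
  {μ ∈ caC 𝔓 | IsSupported 𝔓 μ.totalVariation}

/-- `𝔓` is of class (S): it is equivalent to a nonempty set of supported probability measures. -/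
def IsClassS (𝔓 : Set (Measure Ω)) : Prop :=
  ∃ 𝔔 : Set (Measure Ω), 𝔔.Nonempty ∧ (∀ Q ∈ 𝔔, IsProbabilityMeasure Q) ∧
    EquivalentTo 𝔔 𝔓 ∧ ∀ Q ∈ 𝔔, IsSupported 𝔓 Q

/-! ### Polars -/

/-- The integral `∫ X dμ ∈ [0, ∞]` of `X ∈ L⁰_{c,+}` with respect to `μ ∈ ca_{c,+}`. As `μ` is
positive, it is its own total variation (see `totalVariation_of_nonneg`). -/
def integ {𝔓 : Set (Measure Ω)} (X : L0 𝔓) (μ : SignedMeasure Ω) : ℝ≥0∞ :=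
  ∫⁻ ω, ENNReal.ofReal (X ω) ∂μ.totalVariation

theorem totalVariation_of_nonneg (μ : SignedMeasure Ω) (h : 0 ≤ μ) (A : Set Ω)
    (hA : MeasurableSet A) : μ.totalVariation A = ENNReal.ofReal (μ A) := by
  have hu : 0 ≤[Set.univ] μ := by
    rw [VectorMeasure.restrict_univ, VectorMeasure.restrict_univ]
    exact h
  have hJ : μ.toJordanDecomposition =
      { posPart := μ.toMeasureOfZeroLE Set.univ MeasurableSet.univ hu
        negPart := 0
        mutuallySingular := Measure.MutuallySingular.zero_right } := by
    apply SignedMeasure.toJordanDecomposition_eq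
    simp only [JordanDecomposition.toSignedMeasure, Measure.toSignedMeasure_zero, sub_zero]
    exact (SignedMeasure.toMeasureOfZeroLE_toSignedMeasure μ hu).symm
  simp only [SignedMeasure.totalVariation, hJ, add_zero]
  rw [SignedMeasure.toMeasureOfZeroLE_apply _ hu MeasurableSet.univ hA,
    ← ENNReal.ofReal_eq_coe_nnreal]
  simp

/-- The value of `integ` can be computed with any representative. -/
theorem integ_mk (𝔓 : Set (Measure Ω)) (f : Ω → ℝ) (hf : Measurable f) (μ : SignedMeasure Ω)
    (hμ : μ ∈ caC 𝔓) :
    integ (AEEqFun.mk f hf.aestronglyMeasurable : L0 𝔓) μ =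
      ∫⁻ ω, ENNReal.ofReal (f ω) ∂μ.totalVariation := by
  have hac : μ.totalVariation ≪ qsMeasure 𝔓 := by
    intro A hA
    obtain ⟨N, ⟨hN, h0⟩, hAN⟩ := (qsMeasure_eq_zero_iff 𝔓 A).1 hA
    have := hμ N hN h0
    simp only [Set.mem_singleton_iff, iSup_iSup_eq_left] at this
    exact measure_mono_null hAN this
  refine lintegral_congr_ae ?_
  filter_upwards [hac.ae_le (AEEqFun.coeFn_mk f hf.aestronglyMeasurable)] with ω h
  rw [h]

/-- The one-sided polar `C^⋄`. -/
def polar {𝔓 : Set (Measure Ω)} (C : Set (L0 𝔓)) : Set (SignedMeasure Ω) :=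
  {μ ∈ caCPos 𝔓 | ∀ X ∈ C, integ X μ ≤ 1}

/-- `C` is order closed. -/
def BS1 {𝔓 : Set (Measure Ω)} (C : Set (L0 𝔓)) : Prop := IsOrderClosed C

/-- `C` is its own bipolar with respect to all of `C^⋄`. -/
def BS2 {𝔓 : Set (Measure Ω)} (C : Set (L0 𝔓)) : Prop :=
  C = {X : L0 𝔓 | 0 ≤ X ∧ ∀ μ ∈ polar C, integ X μ ≤ 1}

/-- `C` is its own bipolar with respect to the supported measures in `C^⋄`. -/
def BS3 {𝔓 : Set (Measure Ω)} (C : Set (L0 𝔓)) : Prop :=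
  C = {X : L0 𝔓 | 0 ≤ X ∧ ∀ μ ∈ polar C ∩ scaC 𝔓, integ X μ ≤ 1}

end

end RobustBS

/-! Write `m` for `qsMeasure 𝔓`. A measure `μ ≪ m` is supported by `S` when it lives on `S` and `m`
restricted to `S` is in turn dominated by `μ`. On `S`, μ-a.e. and quasi-sure statements then
coincide, so order arguments in L⁰ reduce to the dominated theory.

(BS3) always gives (BS1). Along a net decreasing to 0 in L⁰, a supported finite measure sees a
sequence converging to 0 almost everywhere (`exists_seq_tendsto_zero`), and Fatou makes each
constraint `∫ X dμ ≤ 1` order closed.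

Under class (S), (BS1) gives (BS3). The restrictions of `X` to supports form a net converging in
order to `X`, because supports exhaust Ω up to polar sets. Hence `X ∉ C` is already visible on one
support (`exists_support_restr_notMem`). There `C` induces a closed convex subset of L²(μ), and
Hahn–Banach yields a density; solidity permits using only its positive part (`exists_density`).

The converses use test sets. The set `{0}` is order closed, and (BS3) for it says that supported
measures detect every nonpolar event, which is class (S). For arbitrary `ν` in the positive cone,
the set `{X ≥ 0 : ∫ X dν ≤ 1}` satisfies (BS2). If it is also order closed, then `ν` is supported:
off the largest event on which `ν` dominates `m`, every nonpolar event contains a nonpolar ν-null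
one, so constants on that complement are order limits of functions with integral 0
(`exists_support_of_isOrderClosed`). -/

namespace RobustBS

open Filter Topology

/-! ### Order convergence, and order closedness of integral constraints -/

section OrderConvergence

variable {Ω : Type u} [MeasurableSpace Ω] {m : Measure Ω}

/-- The class of `X` restricted to the event `S`. -/
noncomputable def restr {S : Set Ω} (hS : MeasurableSet S) {f : Ω → ℝ} (hf : Measurable f) :
    Ω →ₘ[m] ℝ :=
  AEEqFun.mk (S.indicator f) (hf.indicator hS).aestronglyMeasurable

theorem coeFn_restr {S : Set Ω} (hS : MeasurableSet S) {f : Ω → ℝ} (hf : Measurable f) :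
    (restr hS hf : Ω →ₘ[m] ℝ) =ᵐ[m] S.indicator f :=
  AEEqFun.coeFn_mk _ _

theorem coeFn_nonneg {X : Ω →ₘ[m] ℝ} : 0 ≤ X ↔ ∀ᵐ ω ∂m, 0 ≤ X ω := by
  rw [← AEEqFun.coeFn_le]
  constructor
  · intro h
    filter_upwards [h, AEEqFun.coeFn_zero (α := Ω) (μ := m) (β := ℝ)] with ω h1 h2
    simpa [h2] using h1
  · intro h
    filter_upwards [h, AEEqFun.coeFn_zero (α := Ω) (μ := m) (β := ℝ)] with ω h1 h2
    simpa [h2] using h1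

theorem coeFn_nonpos {X : Ω →ₘ[m] ℝ} : X ≤ 0 ↔ ∀ᵐ ω ∂m, X ω ≤ 0 := by
  rw [← AEEqFun.coeFn_le]
  constructor
  · intro h
    filter_upwards [h, AEEqFun.coeFn_zero (α := Ω) (μ := m) (β := ℝ)] with ω h1 h2
    simpa [h2] using h1
  · intro h
    filter_upwards [h, AEEqFun.coeFn_zero (α := Ω) (μ := m) (β := ℝ)] with ω h1 h2
    simpa [h2] using h1

theorem coeFn_abs_sub_le {X Y Z : Ω →ₘ[m] ℝ} :
    |X - Y| ≤ Z ↔ ∀ᵐ ω ∂m, |X ω - Y ω| ≤ Z ω := by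
  rw [← AEEqFun.coeFn_le]
  constructor
  · intro h
    filter_upwards [h, AEEqFun.coeFn_abs (X - Y), AEEqFun.coeFn_sub X Y] with ω h1 h2 h3
    rw [h2, h3] at h1
    exact h1
  · intro h
    filter_upwards [h, AEEqFun.coeFn_abs (X - Y), AEEqFun.coeFn_sub X Y] with ω h1 h2 h3
    rw [h2, h3]
    exact h1

/-- Order closed sets are closed under almost everywhere convergence of sequences. -/
theorem mem_of_tendsto_ae {C : Set (Ω →ₘ[m] ℝ)} (hC : IsOrderClosed C)
    {x : ℕ → Ω →ₘ[m] ℝ} {a : Ω →ₘ[m] ℝ} (hx : ∀ n, x n ∈ C)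
    (h : ∀ᵐ ω ∂m, Tendsto (fun n => x n ω) atTop (𝓝 (a ω))) : a ∈ C := by
  -- Tail suprema supply the decreasing dominating sequence. Where the tail is unbounded the real
  -- supremum defaults to 0, but this only happens on a null set.
  set F : ℕ → Ω → ℝ := fun n ω => ⨆ k, |x (n + k) ω - a ω| with hF
  have hFm : ∀ n, Measurable (F n) := fun n =>
    Measurable.iSup fun k => (((x (n + k)).measurable).sub a.measurable).abs
  have hbdd : ∀ ω, Tendsto (fun n => x n ω) atTop (𝓝 (a ω)) → ∀ n,
      BddAbove (Set.range fun k => |x (n + k) ω - a ω|) := by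
    intro ω hω n
    have h0 : Tendsto (fun n => |x n ω - a ω|) atTop (𝓝 |a ω - a ω|) :=
      (hω.sub_const _).abs
    obtain ⟨M, hM⟩ := h0.bddAbove_range
    refine ⟨M, ?_⟩
    rintro _ ⟨k, rfl⟩
    exact hM ⟨n + k, rfl⟩
  have hFlim : ∀ ω, Tendsto (fun n => x n ω) atTop (𝓝 (a ω)) →
      Tendsto (fun n => F n ω) atTop (𝓝 0) := by
    intro ω hω
    rw [Metric.tendsto_atTop] at hω ⊢
    intro ε hε
    obtain ⟨N, hN⟩ := hω (ε / 2) (by positivity)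
    refine ⟨N, fun n hn => ?_⟩
    have h1 : F n ω ≤ ε / 2 := ciSup_le fun k => by
      have := hN (n + k) (by omega)
      rw [Real.dist_eq] at this
      exact this.le
    have h2 : 0 ≤ F n ω := Real.iSup_nonneg fun k => abs_nonneg _
    rw [Real.dist_eq, sub_zero, abs_of_nonneg h2]
    linarith
  -- `ULift` moves the index set into the universe that `IsOrderClosed` quantifies over.
  let y : ULift.{u} ℕ → Ω →ₘ[m] ℝ := fun n => AEEqFun.mk (F n.down) (hFm _).aestronglyMeasurable
  have hy : ∀ n, y n =ᵐ[m] F n.down := fun n => AEEqFun.coeFn_mk _ _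
  refine hC (ULift.{u} ℕ) (fun n => x n.down) a (fun n => hx _) ⟨y, ?_, ⟨?_, ?_⟩, ?_⟩
  · intro n k hnk
    refine AEEqFun.coeFn_le.1 ?_
    filter_upwards [hy n, hy k, h] with ω h1 h2 h3
    rw [h1, h2]
    refine ciSup_le fun j => ?_
    have hnk' : n.down ≤ k.down := hnk
    obtain ⟨d, hd⟩ := Nat.exists_eq_add_of_le hnk'
    have := le_ciSup (hbdd ω h3 n.down) (d + j)
    simpa only [hd, ← add_assoc] using this
  · rintro _ ⟨n, rfl⟩
    rw [coeFn_nonneg]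
    filter_upwards [hy n] with ω h1
    rw [h1]
    exact Real.iSup_nonneg fun k => abs_nonneg _
  · intro Z hZ
    rw [coeFn_nonpos]
    have : ∀ n : ℕ, ∀ᵐ ω ∂m, Z ω ≤ F n ω := fun n => by
      filter_upwards [AEEqFun.coeFn_le.2 (hZ ⟨⟨n⟩, rfl⟩), hy ⟨n⟩] with ω h1 h2
      rwa [h2] at h1
    filter_upwards [ae_all_iff.2 this, h] with ω h1 h2
    exact ge_of_tendsto' (hFlim ω h2) h1
  · intro n
    rw [coeFn_abs_sub_le]
    filter_upwards [hy n, h] with ω h1 h2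
    rw [h1]
    simpa using le_ciSup (hbdd ω h2 n.down) 0

/-- A decreasing net with infimum `0` admits an increasing sequence of indices along which it
converges to `0` almost everywhere with respect to a given supported finite measure. -/
theorem exists_seq_tendsto_zero {μ : Measure Ω} [IsFiniteMeasure μ] (hμm : μ ≪ m)
    {S : Set Ω} (hS : MeasurableSet S) (hμS : μ Sᶜ = 0) (hmS : m.restrict S ≪ μ)
    {I : Type*} [Preorder I] [IsDirectedOrder I] [Nonempty I] {y : I → Ω →ₘ[m] ℝ}
    (hy : Antitone y) (hglb : IsGLB (Set.range y) 0) :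
    ∃ j : ℕ → I, ∀ᵐ ω ∂μ, Tendsto (fun n => y (j n) ω) atTop (𝓝 0) := by
  have hmono : ∀ {i k}, i ≤ k → ∀ᵐ ω ∂μ, y k ω ≤ y i ω := fun h =>
    hμm.ae_le (AEEqFun.coeFn_le.2 (hy h))
  have hnn : ∀ i, ∀ᵐ ω ∂m, 0 ≤ y i ω := fun i => coeFn_nonneg.1 (hglb.1 ⟨i, rfl⟩)
  -- Truncation at 1 makes the integrals finite without affecting convergence to 0.
  set G : I → Ω → ℝ≥0∞ := fun i ω => min (ENNReal.ofReal (y i ω)) 1 with hG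
  have hGm : ∀ i, Measurable (G i) := fun i =>
    ((y i).measurable.ennreal_ofReal).min measurable_const
  have hGmono : ∀ {i k}, i ≤ k → G k ≤ᵐ[μ] G i := fun h => by
    filter_upwards [hmono h] with ω h1
    exact min_le_min_right _ (ENNReal.ofReal_le_ofReal h1)
  have hGfin : ∀ i, ∫⁻ ω, G i ω ∂μ ≠ ∞ := fun i => by
    refine ne_top_of_le_ne_top (measure_ne_top μ Set.univ) ?_
    calc ∫⁻ ω, G i ω ∂μ ≤ ∫⁻ _, 1 ∂μ := lintegral_mono fun ω => min_le_right _ _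
      _ = μ Set.univ := by simp
  set c := ⨅ i, ∫⁻ ω, G i ω ∂μ with hc
  obtain ⟨v, -, hvt, hvr⟩ := exists_seq_tendsto_sInf
    (Set.range_nonempty fun i => ∫⁻ ω, G i ω ∂μ) (OrderBot.bddBelow _)
  choose i hi using hvr
  -- The indices `i n` approach the infimum `c` of the integrals; `j` is an increasing sequence
  -- dominating them.
  let ub : I → I → I := fun a b => (exists_ge_ge a b).choose
  have hub : ∀ a b, a ≤ ub a b ∧ b ≤ ub a b := fun a b => (exists_ge_ge a b).choose_spec
  let j : ℕ → I := fun n => Nat.rec (i 0) (fun n p => ub p (i (n + 1))) n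
  have hj1 : Monotone j := monotone_nat_of_le_succ fun n => (hub (j n) (i (n + 1))).1
  have hj2 : ∀ n, i n ≤ j n := fun n => by
    cases n with
    | zero => exact le_refl _
    | succ n => exact (hub (j n) (i (n + 1))).2
  set Z : Ω → ℝ≥0∞ := fun ω => ⨅ n, G (j n) ω with hZ
  have hZm : Measurable Z := Measurable.iInf fun n => hGm _
  have hZc : ∫⁻ ω, Z ω ∂μ ≤ c := by
    refine ge_of_tendsto' hvt fun n => ?_
    rw [← hi n]
    calc ∫⁻ ω, Z ω ∂μ ≤ ∫⁻ ω, G (j n) ω ∂μ := lintegral_mono fun ω => iInf_le _ n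
      _ ≤ _ := lintegral_mono_ae (hGmono (hj2 n))
  -- `Z` is an essential infimum of the whole net: taking the minimum with a further `G k` cannot
  -- lower the integral below `c`, so it changes nothing almost everywhere.
  have hZle : ∀ k, ∀ᵐ ω ∂μ, Z ω ≤ G k ω := by
    intro k
    have hcle : c ≤ ∫⁻ ω, min (Z ω) (G k ω) ∂μ := by
      have : (fun ω => min (Z ω) (G k ω)) = fun ω => ⨅ n, min (G (j n) ω) (G k ω) := by
        funext ω
        simp only [hZ]
        exact iInf_inf
      rw [this, lintegral_iInf' (fun n => ((hGm _).min (hGm _)).aemeasurable)]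
      · refine le_iInf fun n => ?_
        refine (iInf_le _ (ub (j n) k)).trans (lintegral_mono_ae ?_)
        filter_upwards [hGmono (hub (j n) k).1, hGmono (hub (j n) k).2] with ω h1 h2
        exact le_min h1 h2
      · have : ∀ᵐ ω ∂μ, ∀ n, G (j (n + 1)) ω ≤ G (j n) ω :=
          ae_all_iff.2 fun n => hGmono (hj1 n.le_succ)
        filter_upwards [this] with ω h
        exact antitone_nat_of_succ_le fun n => min_le_min_right _ (h n)
      · exact ne_top_of_le_ne_top (hGfin (j 0)) (lintegral_mono fun ω => min_le_left _ _)
    have heq : (fun ω => min (Z ω) (G k ω)) =ᵐ[μ] Z := by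
      refine ae_eq_of_ae_le_of_lintegral_le (ae_of_all _ fun ω => min_le_left _ _) ?_
        hZm.aemeasurable (hZc.trans hcle)
      exact ne_top_of_le_ne_top (hGfin k) (lintegral_mono fun ω => min_le_right _ _)
    filter_upwards [heq] with ω h
    rw [← h]
    exact min_le_right _ _
  have hZ0 : ∀ᵐ ω ∂μ, Z ω = 0 := by
    -- This is where the support enters: `Z` cut off outside `S` is a quasi-sure lower bound of the
    -- net, hence at most its infimum 0.
    have hlb : (restr hS hZm.ennreal_toReal : Ω →ₘ[m] ℝ) ≤ 0 := by
      refine hglb.2 ?_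
      rintro _ ⟨k, rfl⟩
      refine AEEqFun.coeFn_le.1 ?_
      have h1 := (ae_restrict_iff' hS).1 (hmS.ae_le (hZle k))
      filter_upwards [h1, hnn k, coeFn_restr hS hZm.ennreal_toReal] with ω h1 h2 h3
      rw [h3]
      by_cases hω : ω ∈ S
      · rw [Set.indicator_of_mem hω]
        refine ENNReal.toReal_le_of_le_ofReal h2 ?_
        exact (h1 hω).trans (min_le_left _ _)
      · rwa [Set.indicator_of_notMem hω]
    have hSmem : ∀ᵐ ω ∂μ, ω ∈ S := by
      rw [ae_iff]
      exact hμS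
    filter_upwards [hμm.ae_le (coeFn_nonpos.1 hlb), hμm.ae_le (coeFn_restr hS hZm.ennreal_toReal),
      hSmem] with ω h1 h2 h3
    rw [h2, Set.indicator_of_mem h3] at h1
    have hZ1 : Z ω ≠ ∞ := ne_top_of_le_ne_top ENNReal.one_ne_top
      ((iInf_le _ 0).trans (min_le_right _ _))
    rcases (ENNReal.toReal_eq_zero_iff _).1 (le_antisymm h1 ENNReal.toReal_nonneg) with h | h
    · exact h
    · exact absurd h hZ1
  refine ⟨j, ?_⟩
  have hjm : ∀ᵐ ω ∂μ, ∀ n, y (j (n + 1)) ω ≤ y (j n) ω :=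
    ae_all_iff.2 fun n => hmono (hj1 n.le_succ)
  have hjn : ∀ᵐ ω ∂μ, ∀ n, 0 ≤ y (j n) ω := ae_all_iff.2 fun n => hμm.ae_le (hnn _)
  filter_upwards [hZ0, hjm, hjn] with ω h0 h1 h2
  have hanti : Antitone fun n => y (j n) ω := antitone_nat_of_succ_le h1
  refine tendsto_order.2 ⟨fun b hb => Eventually.of_forall fun n => hb.trans_le (h2 n),
    fun b hb => ?_⟩
  have hb' : Z ω < min (ENNReal.ofReal b) 1 := by
    rw [h0]
    exact lt_min (ENNReal.ofReal_pos.2 hb) one_pos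
  obtain ⟨n, hn⟩ := iInf_lt_iff.1 hb'
  have hn' : y (j n) ω < b := by
    by_contra hcon
    exact absurd hn (not_lt.2 (min_le_min_right _ (ENNReal.ofReal_le_ofReal (not_lt.1 hcon))))
  filter_upwards [eventually_ge_atTop n] with k hk
  exact (hanti hk).trans_lt hn'

/-- Sublevel sets of the integral of a supported measure are order closed. -/
theorem lintegral_le_one_of_orderTendsto {μ : Measure Ω} [IsFiniteMeasure μ] (hμm : μ ≪ m)
    {S : Set Ω} (hS : MeasurableSet S) (hμS : μ Sᶜ = 0) (hmS : m.restrict S ≪ μ)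
    {I : Type*} [Preorder I] [IsDirectedOrder I] [Nonempty I] {x : I → Ω →ₘ[m] ℝ}
    {a : Ω →ₘ[m] ℝ} (hx : OrderTendsto x a)
    (hint : ∀ i, ∫⁻ ω, ENNReal.ofReal (x i ω) ∂μ ≤ 1) :
    ∫⁻ ω, ENNReal.ofReal (a ω) ∂μ ≤ 1 := by
  obtain ⟨y, hy, hglb, hxy⟩ := hx
  obtain ⟨j, hj⟩ := exists_seq_tendsto_zero hμm hS hμS hmS hy hglb
  have hle : ∀ᵐ ω ∂μ, ∀ n, |x (j n) ω - a ω| ≤ y (j n) ω :=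
    ae_all_iff.2 fun n => hμm.ae_le (coeFn_abs_sub_le.1 (hxy (j n)))
  have hlim : ∀ᵐ ω ∂μ, ENNReal.ofReal (a ω) =
      liminf (fun n => ENNReal.ofReal (x (j n) ω)) atTop := by
    filter_upwards [hj, hle] with ω h1 h2
    have : Tendsto (fun n => x (j n) ω) atTop (𝓝 (a ω)) := by
      rw [tendsto_iff_dist_tendsto_zero]
      exact squeeze_zero (fun _ => dist_nonneg) h2 h1
    exact (ENNReal.tendsto_ofReal this).liminf_eq.symm
  rw [lintegral_congr_ae hlim]
  refine (lintegral_liminf_le fun n => (x (j n)).measurable.ennreal_ofReal).trans ?_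
  refine liminf_le_of_le (by isBoundedDefault) fun b hb => ?_
  obtain ⟨n, hn⟩ := hb.exists
  exact hn.trans (hint _)

theorem nonneg_of_orderTendsto {I : Type*} [Preorder I] {x : I → Ω →ₘ[m] ℝ}
    {a : Ω →ₘ[m] ℝ} (hx : OrderTendsto x a) (h0 : ∀ i, 0 ≤ x i) : 0 ≤ a := by
  obtain ⟨y, -, hglb, hxy⟩ := hx
  have : -a ≤ 0 := by
    refine hglb.2 ?_
    rintro _ ⟨i, rfl⟩
    refine AEEqFun.coeFn_le.1 ?_
    filter_upwards [coeFn_abs_sub_le.1 (hxy i), coeFn_nonneg.1 (h0 i), AEEqFun.coeFn_neg a]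
      with ω h1 h2 h3
    rw [h3, Pi.neg_apply]
    have := (abs_le.1 h1).2
    linarith
  rw [coeFn_nonneg]
  filter_upwards [coeFn_nonpos.1 this, AEEqFun.coeFn_neg a] with ω h1 h2
  rw [h2, Pi.neg_apply] at h1
  linarith

end OrderConvergence

/-! ### Separation in L² over a support -/

section Separation

variable {Ω : Type u} [MeasurableSpace Ω] {m : Measure Ω}

/-- Almost everywhere statements for `μ` hold `m`-almost everywhere on a support of `μ`. -/
theorem ae_of_ae_support {μ : Measure Ω} {S : Set Ω} (hS : MeasurableSet S)
    (hmS : m.restrict S ≪ μ) {p : Ω → Prop} (h : ∀ᵐ ω ∂μ, p ω) : ∀ᵐ ω ∂m, ω ∈ S → p ω :=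
  (ae_restrict_iff' hS).1 (hmS.ae_le h)

theorem restr_le_self {S : Set Ω} (hS : MeasurableSet S) {f : Ω → ℝ} (hf : Measurable f)
    {X : Ω →ₘ[m] ℝ} (hX : 0 ≤ X) (h : ∀ᵐ ω ∂m, ω ∈ S → f ω ≤ X ω) : restr hS hf ≤ X := by
  refine AEEqFun.coeFn_le.1 ?_
  filter_upwards [coeFn_restr hS hf, coeFn_nonneg.1 hX, h] with ω h1 h2 h3
  rw [h1]
  by_cases hω : ω ∈ S
  · rw [Set.indicator_of_mem hω]
    exact h3 hω
  · rwa [Set.indicator_of_notMem hω]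

theorem restr_nonneg {S : Set Ω} (hS : MeasurableSet S) {f : Ω → ℝ} (hf : Measurable f)
    (h : ∀ᵐ ω ∂m, ω ∈ S → 0 ≤ f ω) : (0 : Ω →ₘ[m] ℝ) ≤ restr hS hf := by
  rw [coeFn_nonneg]
  filter_upwards [coeFn_restr hS hf, h] with ω h1 h3
  rw [h1]
  by_cases hω : ω ∈ S
  · rw [Set.indicator_of_mem hω]
    exact h3 hω
  · rw [Set.indicator_of_notMem hω]

/-- If the restriction of `X` to `S` lies outside an order closed set, then so does that of some
truncation of `X`. -/
theorem exists_truncation_notMem {C : Set (Ω →ₘ[m] ℝ)} (hC : IsOrderClosed C) {S : Set Ω}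
    (hS : MeasurableSet S) {f : Ω → ℝ} (hf : Measurable f) (h : restr hS hf ∉ C) :
    ∃ n : ℕ, restr hS (hf.min (measurable_const (a := (n : ℝ)))) ∉ C := by
  by_contra! hcon
  refine h (mem_of_tendsto_ae hC hcon ?_)
  have h1 : ∀ᵐ ω ∂m, ∀ n : ℕ, (restr hS (hf.min (measurable_const (a := (n : ℝ)))) : Ω →ₘ[m] ℝ) ω =
      S.indicator (fun ω => min (f ω) n) ω := ae_all_iff.2 fun n => coeFn_restr _ _
  filter_upwards [h1, coeFn_restr hS hf] with ω h1 h2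
  rw [h2]
  simp only [h1]
  by_cases hω : ω ∈ S
  · simp only [Set.indicator_of_mem hω]
    refine tendsto_const_nhds.congr' ?_
    obtain ⟨N, hN⟩ := exists_nat_ge (f ω)
    filter_upwards [eventually_ge_atTop N] with n hn
    exact (min_eq_left (hN.trans (Nat.cast_le.2 hn))).symm
  · simp only [Set.indicator_of_notMem hω]
    exact tendsto_const_nhds

/-- Separation of a point from an order closed convex solid set by a density with respect to a
supported finite measure. -/
theorem exists_density {μ : Measure Ω} [IsFiniteMeasure μ]
    {S : Set Ω} (hS : MeasurableSet S) (hμm : μ ≪ m) (hμS : μ Sᶜ = 0) (hmS : m.restrict S ≪ μ)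
    {C : Set (Ω →ₘ[m] ℝ)} (hne : C.Nonempty) (hpos : ∀ X ∈ C, 0 ≤ X) (hconv : Convex ℝ C)
    (hsol : IsSolidPos C) (hC : IsOrderClosed C) {X₀ : Ω →ₘ[m] ℝ} (hX₀ : 0 ≤ X₀)
    (hnot : restr hS X₀.measurable ∉ C) :
    ∃ h : Ω → ℝ, Measurable h ∧ Integrable h μ ∧
      (∀ X ∈ C, ∫⁻ ω, ENNReal.ofReal (X ω) ∂(μ.withDensity fun ω => ENNReal.ofReal (h ω)) ≤ 1) ∧
      1 < ∫⁻ ω, ENNReal.ofReal (X₀ ω) ∂(μ.withDensity fun ω => ENNReal.ofReal (h ω)) := by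
  have hSmem : ∀ᵐ ω ∂μ, ω ∈ S := by
    rw [ae_iff]
    exact hμS
  -- `X₀` need not be square integrable, so a bounded truncation is separated instead.
  obtain ⟨n₀, hn₀⟩ := exists_truncation_notMem hC hS X₀.measurable hnot
  have hL : ∀ g : Lp ℝ 2 μ, Measurable (g : Ω → ℝ) := fun g => (Lp.stronglyMeasurable g).measurable
  set K : Set (Lp ℝ 2 μ) := {g | restr hS (hL g) ∈ C} with hK
  -- membership in `K` can be tested on representatives
  have hrestr : ∀ {g : Lp ℝ 2 μ} {f : Ω → ℝ} (hf : Measurable f), g =ᵐ[μ] f →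
      (restr hS (hL g) : Ω →ₘ[m] ℝ) = restr hS hf := by
    intro g f hf hgf
    refine AEEqFun.ext ?_
    filter_upwards [coeFn_restr (m := m) hS (hL g), coeFn_restr (m := m) hS hf,
      ae_of_ae_support hS hmS hgf] with ω h1 h2 h3
    rw [h1, h2]
    by_cases hω : ω ∈ S
    · rw [Set.indicator_of_mem hω, Set.indicator_of_mem hω, h3 hω]
    · rw [Set.indicator_of_notMem hω, Set.indicator_of_notMem hω]
  have hzero : (0 : Ω →ₘ[m] ℝ) ∈ C := by
    obtain ⟨X, hX⟩ := hne
    exact hsol X hX 0 le_rfl (hpos X hX)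
  have hK0 : (0 : Lp ℝ 2 μ) ∈ K := by
    have : (restr hS (hL 0) : Ω →ₘ[m] ℝ) = 0 := by
      refine AEEqFun.ext ?_
      filter_upwards [coeFn_restr (m := m) hS (hL 0), AEEqFun.coeFn_zero (α := Ω) (μ := m) (β := ℝ),
        ae_of_ae_support hS hmS (Lp.coeFn_zero ℝ 2 μ)] with ω h1 h2 h3
      rw [h1, h2]
      by_cases hω : ω ∈ S
      · rw [Set.indicator_of_mem hω, h3 hω]
      · rw [Set.indicator_of_notMem hω]; rfl
    rw [hK, Set.mem_ofPred_eq, this]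
    exact hzero
  have hKconv : Convex ℝ K := by
    intro g hg k hk a b ha hb hab
    have : (restr hS (hL (a • g + b • k)) : Ω →ₘ[m] ℝ) =
        a • restr hS (hL g) + b • restr hS (hL k) := by
      refine AEEqFun.ext ?_
      have h0 : ∀ᵐ ω ∂μ, (a • g + b • k : Lp ℝ 2 μ) ω = a * g ω + b * k ω := by
        filter_upwards [Lp.coeFn_add (a • g) (b • k), Lp.coeFn_smul a g, Lp.coeFn_smul b k]
          with ω h1 h2 h3
        rw [h1, Pi.add_apply, h2, h3]
        rfl
      filter_upwards [coeFn_restr (m := m) hS (hL (a • g + b • k)),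
        coeFn_restr (m := m) hS (hL g), coeFn_restr (m := m) hS (hL k),
        AEEqFun.coeFn_add (a • (restr hS (hL g) : Ω →ₘ[m] ℝ)) (b • restr hS (hL k)),
        AEEqFun.coeFn_smul a (restr hS (hL g) : Ω →ₘ[m] ℝ),
        AEEqFun.coeFn_smul b (restr hS (hL k) : Ω →ₘ[m] ℝ),
        ae_of_ae_support hS hmS h0] with ω h1 h2 h3 h4 h5 h6 h7
      rw [h1, h4, Pi.add_apply, h5, h6, Pi.smul_apply, Pi.smul_apply, h2, h3]
      by_cases hω : ω ∈ S
      · simp only [Set.indicator_of_mem hω, h7 hω, smul_eq_mul]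
      · simp only [Set.indicator_of_notMem hω, smul_zero, add_zero]
    rw [hK, Set.mem_ofPred_eq, this]
    exact hconv hg hk ha hb hab
  have hKclosed : IsClosed K := by
    refine IsSeqClosed.isClosed fun x g hx hxg => ?_
    obtain ⟨ns, -, hns⟩ := (tendstoInMeasure_of_tendsto_Lp hxg).exists_seq_tendsto_ae
    refine mem_of_tendsto_ae hC (x := fun n => restr hS (hL (x (ns n)))) (fun n => hx _) ?_
    have h1 : ∀ᵐ ω ∂m, ∀ n, (restr hS (hL (x (ns n))) : Ω →ₘ[m] ℝ) ω =
        S.indicator (x (ns n)) ω := ae_all_iff.2 fun n => coeFn_restr _ _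
    filter_upwards [h1, coeFn_restr (m := m) hS (hL g), ae_of_ae_support hS hmS hns] with ω h1 h2 h3
    rw [h2]
    simp only [h1]
    by_cases hω : ω ∈ S
    · simp only [Set.indicator_of_mem hω]
      exact h3 hω
    · simp only [Set.indicator_of_notMem hω]
      exact tendsto_const_nhds
  -- bounded nonnegative functions are square integrable
  have hbound : ∀ {f : Ω → ℝ} (n : ℕ), Measurable f → (∀ᵐ ω ∂μ, 0 ≤ f ω) → (∀ ω, f ω ≤ n) →
      MemLp f 2 μ := by
    intro f n hf h0 h1
    refine MemLp.of_bound hf.aestronglyMeasurable n ?_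
    filter_upwards [h0] with ω h0
    rw [Real.norm_eq_abs, abs_of_nonneg h0]
    exact h1 ω
  have hX₀μ : ∀ᵐ ω ∂μ, 0 ≤ X₀ ω := hμm.ae_le (coeFn_nonneg.1 hX₀)
  have hwm : Measurable fun ω => min (X₀ ω) (n₀ : ℝ) := X₀.measurable.min measurable_const
  have hw0 : ∀ᵐ ω ∂μ, 0 ≤ min (X₀ ω) (n₀ : ℝ) := by
    filter_upwards [hX₀μ] with ω h
    exact le_min h n₀.cast_nonneg
  have hw : MemLp (fun ω => min (X₀ ω) (n₀ : ℝ)) 2 μ := hbound n₀ hwm hw0 fun ω => min_le_right _ _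
  have hwK : hw.toLp _ ∉ K := by
    intro hmem
    rw [hK, Set.mem_ofPred_eq, hrestr hwm hw.coeFn_toLp] at hmem
    exact hn₀ hmem
  -- Here `φ < s` on `K` and `s < φ` at the truncation; `0 ∈ K` forces `s > 0`, so the Riesz
  -- representative `d` can be divided by `s`.
  obtain ⟨φ, s, hφK, hφw⟩ := geometric_hahn_banach_closed_point hKconv hKclosed hwK
  have hs : 0 < s := by simpa using hφK 0 hK0
  set d : Lp ℝ 2 μ := (InnerProductSpace.toDual ℝ (Lp ℝ 2 μ)).symm φ with hd
  have hφ : ∀ {f : Ω → ℝ} (hf : MemLp f 2 μ), φ (hf.toLp f) = ∫ ω, d ω * f ω ∂μ := by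
    intro f hf
    rw [← InnerProductSpace.toDual_symm_apply (𝕜 := ℝ), ← hd, L2.inner_def]
    refine integral_congr_ae ?_
    filter_upwards [hf.coeFn_toLp] with ω h
    rw [h]
    simp [mul_comm]
  have hdm : Measurable (d : Ω → ℝ) := hL d
  have hd2 : MemLp d 2 μ := Lp.memLp d
  have hdint : Integrable d μ := hd2.integrable (by norm_num)
  refine ⟨fun ω => d ω / s, hdm.div_const s, hdint.div_const s, ?_, ?_⟩
  · intro X hX
    have hXμ : ∀ᵐ ω ∂μ, 0 ≤ X ω := hμm.ae_le (coeFn_nonneg.1 (hpos X hX))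
    rw [lintegral_withDensity_eq_lintegral_mul _ (hdm.div_const s).ennreal_ofReal
      X.measurable.ennreal_ofReal]
    set P : Set Ω := {ω | 0 < d ω} with hP
    have hPm : MeasurableSet P := measurableSet_lt measurable_const hdm
    -- Solidity keeps the truncations of `X` cut off to `{d > 0}` inside `C`. On them `d` agrees
    -- with its positive part, so the bound on `φ` passes to that part, and Fatou removes the
    -- truncation.
    set t : ℕ → Ω → ℝ := fun n => P.indicator fun ω => min (X ω) (n : ℝ) with ht
    have htm : ∀ n, Measurable (t n) := fun n =>
      (X.measurable.min measurable_const).indicator hPm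
    have ht0 : ∀ {ω} n, 0 ≤ X ω → 0 ≤ t n ω := fun {ω} n h => by
      by_cases hω : ω ∈ P
      · simp only [ht, Set.indicator_of_mem hω]
        exact le_min h n.cast_nonneg
      · simp only [ht, Set.indicator_of_notMem hω, le_refl]
    have htn : ∀ n, ∀ ω, t n ω ≤ n := fun n ω => by
      by_cases hω : ω ∈ P
      · simp only [ht, Set.indicator_of_mem hω]
        exact min_le_right _ _
      · simp only [ht, Set.indicator_of_notMem hω]
        exact n.cast_nonneg
    have htL : ∀ n, MemLp (t n) 2 μ := fun n =>
      hbound n (htm n) (hXμ.mono fun ω h => ht0 n h) (htn n)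
    have htK : ∀ n, (htL n).toLp _ ∈ K := by
      intro n
      rw [hK, Set.mem_ofPred_eq, hrestr (htm n) (htL n).coeFn_toLp]
      refine hsol X hX _ (restr_nonneg hS _ ?_) (restr_le_self hS _ (hpos X hX) ?_)
      · filter_upwards [coeFn_nonneg.1 (hpos X hX)] with ω h _
        exact ht0 n h
      · filter_upwards [coeFn_nonneg.1 (hpos X hX)] with ω h _
        by_cases hω : ω ∈ P
        · simp only [ht, Set.indicator_of_mem hω]
          exact min_le_left _ _
        · simpa only [ht, Set.indicator_of_notMem hω] using h
    have hprod0 : ∀ n, ∀ᵐ ω ∂μ, 0 ≤ d ω * t n ω := fun n => by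
      filter_upwards [hXμ] with ω h
      by_cases hω : ω ∈ P
      · exact mul_nonneg (le_of_lt hω) (ht0 n h)
      · simp [ht, Set.indicator_of_notMem hω]
    have hbd : ∀ n, ∫⁻ ω, ENNReal.ofReal (d ω / s * t n ω) ∂μ ≤ 1 := by
      intro n
      have h1 := hφK _ (htK n)
      rw [hφ (htL n)] at h1
      have hi : Integrable (fun ω => d ω * t n ω) μ := hd2.integrable_mul (htL n)
      have h2 : ∀ ω, d ω / s * t n ω = d ω * t n ω / s := fun ω => by ring
      simp only [h2]
      rw [← ofReal_integral_eq_lintegral_ofReal (hi.div_const s)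
        ((hprod0 n).mono fun ω h => div_nonneg h hs.le), integral_div]
      refine ENNReal.ofReal_le_one.2 ?_
      rw [div_le_one hs]
      exact h1.le
    have hlim : ∀ᵐ ω ∂μ, ENNReal.ofReal (d ω / s) * ENNReal.ofReal (X ω) =
        liminf (fun n => ENNReal.ofReal (d ω / s * t n ω)) atTop := by
      filter_upwards [hXμ] with ω h
      have : ∀ᶠ n : ℕ in atTop, ENNReal.ofReal (d ω / s * t n ω) =
          ENNReal.ofReal (d ω / s) * ENNReal.ofReal (X ω) := by
        obtain ⟨N, hN⟩ := exists_nat_ge (X ω)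
        filter_upwards [eventually_ge_atTop N] with n hn
        by_cases hω : ω ∈ P
        · simp only [ht, Set.indicator_of_mem hω]
          rw [min_eq_left (hN.trans (Nat.cast_le.2 hn)),
            ENNReal.ofReal_mul (div_nonneg (le_of_lt hω) hs.le)]
        · have h3 : d ω / s ≤ 0 := div_nonpos_of_nonpos_of_nonneg (not_lt.1 hω) hs.le
          simp [ht, Set.indicator_of_notMem hω, ENNReal.ofReal_of_nonpos h3]
      exact (tendsto_const_nhds.congr' (this.mono fun _ h => h.symm)).liminf_eq.symm
    simp only [Pi.mul_apply]
    rw [lintegral_congr_ae hlim]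
    refine (lintegral_liminf_le fun n =>
      ((hdm.div_const s).mul (htm n)).ennreal_ofReal).trans ?_
    refine liminf_le_of_le (by isBoundedDefault) fun b hb => ?_
    obtain ⟨n, hn⟩ := hb.exists
    exact hn.trans (hbd n)
  · rw [lintegral_withDensity_eq_lintegral_mul _ (hdm.div_const s).ennreal_ofReal
      X₀.measurable.ennreal_ofReal]
    rw [hφ hw] at hφw
    set w : Ω → ℝ := fun ω => min (X₀ ω) (n₀ : ℝ)
    have hi : Integrable (fun ω => d ω * w ω) μ := hd2.integrable_mul hw
    have h1 : 1 < ∫ ω, d ω * w ω / s ∂μ := by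
      rw [integral_div, lt_div_iff₀ hs, one_mul]
      exact hφw
    -- Discarding the negative part of `d` only increases the integral of the nonnegative `w`.
    have h2 : ENNReal.ofReal (∫ ω, d ω * w ω / s ∂μ) ≤ ∫⁻ ω, ENNReal.ofReal (d ω * w ω / s) ∂μ := by
      rw [integral_eq_lintegral_pos_part_sub_lintegral_neg_part (hi.div_const s)]
      refine (ENNReal.ofReal_le_ofReal (sub_le_self _ ENNReal.toReal_nonneg)).trans ?_
      exact ENNReal.ofReal_toReal_le
    refine (ENNReal.one_lt_ofReal.2 h1).trans_le (h2.trans (lintegral_mono_ae ?_))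
    filter_upwards [hw0] with ω h0
    simp only [Pi.mul_apply]
    have h3 : d ω * w ω / s = d ω / s * w ω := by ring
    rw [h3, ENNReal.ofReal_mul' h0]
    gcongr
    exact min_le_left _ _

end Separation

/-! ### Order closed sublevel sets force a support -/

section StrictPositivity

variable {Ω : Type u} [MeasurableSpace Ω] {m : Measure Ω}

/-- A finite measure `ν` has a largest event on which it is strictly positive relative to `m`. -/
theorem exists_maximal_strictly_positive (m ν : Measure Ω) [IsFiniteMeasure ν] :
    ∃ S, MeasurableSet S ∧ m.restrict S ≪ ν ∧
      ∀ B, MeasurableSet B → m.restrict B ≪ ν → ν (B \ S) = 0 := by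
  set D : Set (Set Ω) := {B | MeasurableSet B ∧ m.restrict B ≪ ν} with hD
  have hne : (ν '' D).Nonempty := ⟨_, ∅, ⟨MeasurableSet.empty, by
    rw [Measure.restrict_empty]; exact Measure.AbsolutelyContinuous.zero _⟩, rfl⟩
  obtain ⟨v, -, hv, hvD⟩ := exists_seq_tendsto_sSup hne (OrderTop.bddAbove _)
  choose B hB hBv using hvD
  -- Closure under countable unions is what lets the supremum of `ν` over `D` be attained.
  have hSD : ∀ {U : ℕ → Set Ω}, (∀ n, U n ∈ D) → (⋃ n, U n) ∈ D := by
    intro U hU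
    refine ⟨MeasurableSet.iUnion fun n => (hU n).1, Measure.AbsolutelyContinuous.mk ?_⟩
    intro A hA hA0
    rw [Measure.restrict_apply hA, Set.inter_iUnion, measure_iUnion_null_iff]
    intro n
    rw [← Measure.restrict_apply hA]
    exact (hU n).2 hA0
  have hS := hSD hB
  refine ⟨⋃ n, B n, hS.1, hS.2, fun A hA hAν => ?_⟩
  have hU : (⋃ n, B n) ∪ A ∈ D := by
    refine ⟨hS.1.union hA, Measure.AbsolutelyContinuous.mk fun N hN hN0 => ?_⟩
    rw [Measure.restrict_apply hN, Set.inter_union_distrib_left]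
    refine measure_union_null ?_ ?_
    · rw [← Measure.restrict_apply hN]
      exact hS.2 hN0
    · rw [← Measure.restrict_apply hN]
      exact hAν hN0
  have h1 : ν ((⋃ n, B n) ∪ A) ≤ ν (⋃ n, B n) := by
    refine (le_sSup (Set.mem_image_of_mem ν hU)).trans (le_of_tendsto' hv fun n => ?_)
    rw [← hBv n]
    exact measure_mono (Set.subset_iUnion B n)
  have h2 : ν ((⋃ n, B n) ∪ A) = ν (⋃ n, B n) + ν (A \ ⋃ n, B n) := by
    rw [← measure_union Set.disjoint_sdiff_right (hA.diff hS.1), Set.union_sdiff_self]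
  rw [h2] at h1
  by_contra hcon
  exact absurd h1 (not_le.2 (ENNReal.lt_add_right (measure_ne_top _ _) hcon))

/-- A finite measure whose unit sublevel set is order closed has a support. -/
theorem exists_support_of_isOrderClosed {ν : Measure Ω} [IsFiniteMeasure ν] (hνm : ν ≪ m)
    (hC : IsOrderClosed {X : Ω →ₘ[m] ℝ | 0 ≤ X ∧ ∫⁻ ω, ENNReal.ofReal (X ω) ∂ν ≤ 1}) :
    ∃ S, MeasurableSet S ∧ ν Sᶜ = 0 ∧ m.restrict S ≪ ν := by
  obtain ⟨S, hS, hSν, hmax⟩ := exists_maximal_strictly_positive m ν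
  refine ⟨S, hS, ?_, hSν⟩
  set T := Sᶜ with hT
  have hTm : MeasurableSet T := hS.compl
  -- Otherwise `ν` would dominate `m` on `N`; maximality of `S` then gives `ν N = 0`, and `N` itself
  -- is the required event.
  have hrich : ∀ N, MeasurableSet N → N ⊆ T → m N ≠ 0 →
      ∃ A, MeasurableSet A ∧ A ⊆ N ∧ ν A = 0 ∧ m A ≠ 0 := by
    intro N hN hNT hN0
    by_contra! hcon
    have h1 : m.restrict N ≪ ν := Measure.AbsolutelyContinuous.mk fun A hA hA0 => by
      rw [Measure.restrict_apply hA]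
      exact hcon _ (hA.inter hN) Set.inter_subset_right (measure_mono_null Set.inter_subset_left hA0)
    have h2 := hmax N hN h1
    rw [Set.sdiff_eq, Set.inter_eq_left.2 hNT] at h2
    exact hN0 (hcon N hN le_rfl h2)
  have hbound : ∀ n : ℕ, n * ν T ≤ 1 := by
    intro n
    have hcm : Measurable fun _ : Ω => (n : ℝ) := measurable_const
    -- Over the ν-null events `A`, directed by inclusion, `n · 1_{T ∩ A}` has integral 0 and
    -- converges in order to `n · 1_T`, with error `n · 1_{T \ A}`; `hrich` makes the infimum of the
    -- errors 0.
    let I := {A : Set Ω // MeasurableSet A ∧ ν A = 0}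
    have : IsDirectedOrder I := ⟨fun A B => ⟨⟨A.1 ∪ B.1, A.2.1.union B.2.1,
      measure_union_null A.2.2 B.2.2⟩, Set.subset_union_left, Set.subset_union_right⟩⟩
    have : Nonempty I := ⟨⟨∅, MeasurableSet.empty, measure_empty⟩⟩
    have hmem := hC I (fun A => restr (hTm.inter A.2.1) hcm) (restr hTm hcm) ?_ ?_
    · have h1 := hmem.2
      rw [lintegral_congr_ae (hνm.ae_le ((coeFn_restr (m := m) hTm hcm).mono fun ω h =>
        show _ = T.indicator (fun _ => (n : ℝ≥0∞)) ω from ?_)), lintegral_indicator_const hTm] at h1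
      · exact h1
      · simp only [h]
        by_cases hω : ω ∈ T <;> simp [hω]
    · intro A
      refine ⟨restr_nonneg _ _ (ae_of_all _ fun ω _ => n.cast_nonneg), ?_⟩
      have hA : ∀ᵐ ω ∂ν, ω ∉ A.1 := by
        rw [ae_iff]
        simpa using A.2.2
      have : ∫⁻ ω, ENNReal.ofReal ((restr (hTm.inter A.2.1) hcm : Ω →ₘ[m] ℝ) ω) ∂ν =
          ∫⁻ _, 0 ∂ν := by
        refine lintegral_congr_ae ?_
        filter_upwards [hA, hνm.ae_le (coeFn_restr (m := m) (hTm.inter A.2.1) hcm)] with ω h1 h2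
        rw [h2, Set.indicator_of_notMem fun h => h1 h.2, ENNReal.ofReal_zero]
      rw [this]
      simp
    · refine ⟨fun A => restr (hTm.diff A.2.1) hcm, ?_, ⟨?_, ?_⟩, ?_⟩
      · intro A B hAB
        refine restr_le_self _ _ (restr_nonneg _ _ (ae_of_all _ fun ω _ => n.cast_nonneg)) ?_
        filter_upwards [coeFn_restr (m := m) (hTm.diff A.2.1) hcm] with ω h1 h2
        rw [h1, Set.indicator_of_mem (show ω ∈ T \ A.1 from ⟨h2.1, fun h => h2.2 (hAB h)⟩)]
      · rintro _ ⟨A, rfl⟩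
        exact restr_nonneg _ _ (ae_of_all _ fun ω _ => n.cast_nonneg)
      · intro Z hZ
        have hZle : ∀ A : I, ∀ᵐ ω ∂m, ω ∉ T \ A.1 → Z ω ≤ 0 := fun A => by
          filter_upwards [AEEqFun.coeFn_le.2 (hZ ⟨A, rfl⟩),
            coeFn_restr (m := m) (hTm.diff A.2.1) hcm] with ω h1 h2 h3
          rwa [h2, Set.indicator_of_notMem h3] at h1
        rw [coeFn_nonpos]
        have hPm : MeasurableSet {ω | 0 < Z ω} := measurableSet_lt measurable_const Z.measurable
        have hout : m ({ω | 0 < Z ω} \ T) = 0 := by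
          refine measure_mono_null ?_
            (ae_iff.1 (hZle ⟨∅, MeasurableSet.empty, measure_empty⟩))
          intro ω hω hcon
          exact absurd (hcon fun h => hω.2 h.1) (not_le.2 hω.1)
        have hin : m ({ω | 0 < Z ω} ∩ T) = 0 := by
          by_contra hcon
          obtain ⟨A, hA, hAN, hA0, hAm⟩ := hrich _ (hPm.inter hTm) Set.inter_subset_right hcon
          refine hAm (measure_mono_null ?_ (ae_iff.1 (hZle ⟨A, hA, hA0⟩)))
          intro ω hω hcon
          exact absurd (hcon fun h => h.2 hω) (not_le.2 (hAN hω).1)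
        rw [ae_iff]
        simp only [not_le]
        rw [← Set.inter_union_sdiff {ω | 0 < Z ω} T]
        exact measure_union_null hin hout
      · intro A
        rw [coeFn_abs_sub_le]
        filter_upwards [coeFn_restr (m := m) (hTm.diff A.2.1) hcm, coeFn_restr (m := m) hTm hcm,
          coeFn_restr (m := m) (hTm.inter A.2.1) hcm] with ω h1 h2 h3
        rw [h1, h2, h3]
        by_cases hω : ω ∈ T <;> by_cases hA : ω ∈ A.1 <;> simp [hω, hA]
  by_contra hcon
  obtain ⟨n, hn⟩ := ENNReal.exists_nat_mul_gt hcon ENNReal.one_ne_top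
  exact absurd (hbound n) (not_le.2 hn)

end StrictPositivity

/-! ### From quasi-sure notions to `qsMeasure`, and the bipolar implications -/

section Translation

variable {Ω : Type u} [MeasurableSpace Ω] {𝔓 : Set (Measure Ω)}

theorem isPolar_iff {A : Set Ω} : IsPolar 𝔓 A ↔ MeasurableSet A ∧ qsMeasure 𝔓 A = 0 := by
  refine and_congr_right fun hA => ?_
  simp [qsMeasure, upperProb, Measure.sum_apply _ hA]

theorem dominatedBy_singleton_iff {μ : Measure Ω} :
    DominatedBy {μ} 𝔓 ↔ μ ≪ qsMeasure 𝔓 := by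
  constructor
  · intro h
    refine Measure.AbsolutelyContinuous.mk fun N hN h0 => ?_
    simpa using h N hN (isPolar_iff.2 ⟨hN, h0⟩).2
  · intro h N hN h0
    simpa using h (isPolar_iff.1 ⟨hN, h0⟩).2

theorem absolutelyContinuous_of_dominatedBy {𝔔 : Set (Measure Ω)} (h : DominatedBy 𝔔 𝔓)
    {Q : Measure Ω} (hQ : Q ∈ 𝔔) : Q ≪ qsMeasure 𝔓 := by
  refine dominatedBy_singleton_iff.1 fun N hN h0 => ?_
  have := h N hN h0
  simp only [ENNReal.iSup_eq_zero] at this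
  simpa using this Q hQ

theorem isSupported_iff {μ : Measure Ω} :
    IsSupported 𝔓 μ ↔
      ∃ S, MeasurableSet S ∧ μ Sᶜ = 0 ∧ (qsMeasure 𝔓).restrict S ≪ μ := by
  refine exists_congr fun S => and_congr_right fun hS => and_congr_right fun _ => ?_
  constructor
  · intro h
    refine Measure.AbsolutelyContinuous.mk fun N hN h0 => ?_
    rw [Measure.restrict_apply hN]
    exact (isPolar_iff.1 (h N hN (measure_mono_null Set.inter_subset_left h0))).2
  · intro h N hN h0
    refine isPolar_iff.2 ⟨hN.inter hS, ?_⟩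
    have := h h0
    rwa [Measure.restrict_apply (hN.inter hS), Set.inter_assoc, Set.inter_self] at this

theorem totalVariation_toSignedMeasure (μ : Measure Ω) [IsFiniteMeasure μ] :
    μ.toSignedMeasure.totalVariation = μ := by
  ext A hA
  rw [totalVariation_of_nonneg _ (Measure.zero_le_toSignedMeasure μ) A hA,
    Measure.toSignedMeasure_apply_measurable hA, measureReal_def,
    ENNReal.ofReal_toReal (measure_ne_top _ _)]

theorem integ_toSignedMeasure (X : L0 𝔓) (μ : Measure Ω) [IsFiniteMeasure μ] :
    integ X μ.toSignedMeasure = ∫⁻ ω, ENNReal.ofReal (X ω) ∂μ := by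
  rw [integ, totalVariation_toSignedMeasure]

theorem toSignedMeasure_mem_caCPos {μ : Measure Ω} [IsFiniteMeasure μ]
    (h : μ ≪ qsMeasure 𝔓) : μ.toSignedMeasure ∈ caCPos 𝔓 := by
  refine ⟨?_, Measure.zero_le_toSignedMeasure μ⟩
  change DominatedBy _ _
  rw [totalVariation_toSignedMeasure]
  exact dominatedBy_singleton_iff.2 h

theorem toSignedMeasure_mem_polar_iff {μ : Measure Ω} [IsFiniteMeasure μ]
    (h : μ ≪ qsMeasure 𝔓) {C : Set (L0 𝔓)} :
    μ.toSignedMeasure ∈ polar C ↔ ∀ X ∈ C, ∫⁻ ω, ENNReal.ofReal (X ω) ∂μ ≤ 1 := by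
  constructor
  · intro hμ X hX
    rw [← integ_toSignedMeasure]
    exact hμ.2 X hX
  · intro hμ
    refine ⟨toSignedMeasure_mem_caCPos h, fun X hX => ?_⟩
    rw [integ_toSignedMeasure]
    exact hμ X hX

theorem toSignedMeasure_mem_scaC {μ : Measure Ω} [IsFiniteMeasure μ]
    (h : μ ≪ qsMeasure 𝔓) (hs : IsSupported 𝔓 μ) : μ.toSignedMeasure ∈ scaC 𝔓 := by
  refine ⟨(toSignedMeasure_mem_caCPos h).1, ?_⟩
  rwa [totalVariation_toSignedMeasure]

theorem bs1_of_bs3 {C : Set (L0 𝔓)} (h : BS3 C) : BS1 C := by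
  intro I _ _ _ x a hx hxa
  have hx' : ∀ i, x i ∈ {X : L0 𝔓 | 0 ≤ X ∧ ∀ μ ∈ polar C ∩ scaC 𝔓, integ X μ ≤ 1} :=
    fun i => h ▸ hx i
  rw [h]
  refine ⟨nonneg_of_orderTendsto hxa fun i => (hx' i).1, fun μ hμ => ?_⟩
  obtain ⟨S, hS, hμS, hmS⟩ := isSupported_iff.1 hμ.2.2
  exact lintegral_le_one_of_orderTendsto (dominatedBy_singleton_iff.1 hμ.2.1) hS hμS hmS hxa
    fun i => (hx' i).2 μ hμ

/-- Under class (S), membership in an order closed set is detected on supports of finite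
measures. -/
theorem exists_support_restr_notMem {𝔔 : Set (Measure Ω)} (hprob : ∀ Q ∈ 𝔔, IsProbabilityMeasure Q)
    (heq : EquivalentTo 𝔔 𝔓) (hsupp : ∀ Q ∈ 𝔔, IsSupported 𝔓 Q) {C : Set (L0 𝔓)}
    (hC : BS1 C) {X : L0 𝔓} (hX : 0 ≤ X) (hXC : X ∉ C) :
    ∃ (S : Set Ω) (hS : MeasurableSet S) (μ : Measure Ω), IsFiniteMeasure μ ∧
      μ ≪ qsMeasure 𝔓 ∧ μ Sᶜ = 0 ∧ (qsMeasure 𝔓).restrict S ≪ μ ∧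
      restr hS X.measurable ∉ C := by
  by_contra! hcon
  refine hXC ?_
  have hXnn := coeFn_nonneg.1 hX
  -- The index set consists of all supports of finite measures; it is directed because a union of
  -- two supports carries the sum of the measures.
  let I := {B : Set Ω // MeasurableSet B ∧ ∃ μ : Measure Ω, IsFiniteMeasure μ ∧
    μ ≪ qsMeasure 𝔓 ∧ μ Bᶜ = 0 ∧ (qsMeasure 𝔓).restrict B ≪ μ}
  have : IsDirectedOrder I := by
    refine ⟨fun ⟨A, hA, μ, hμ, hμm, hμA, hmA⟩ ⟨B, hB, ν, hν, hνm, hνB, hmB⟩ =>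
      ⟨⟨A ∪ B, hA.union hB, μ + ν, inferInstance, hμm.add_left hνm, ?_, ?_⟩,
        Set.subset_union_left, Set.subset_union_right⟩⟩
    · rw [Measure.add_apply, add_eq_zero]
      exact ⟨measure_mono_null (Set.compl_subset_compl.2 Set.subset_union_left) hμA,
        measure_mono_null (Set.compl_subset_compl.2 Set.subset_union_right) hνB⟩
    · refine Measure.AbsolutelyContinuous.mk fun N hN h0 => ?_
      rw [Measure.add_apply, add_eq_zero] at h0
      rw [Measure.restrict_apply hN, Set.inter_union_distrib_left]
      refine measure_union_null ?_ ?_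
      · rw [← Measure.restrict_apply hN]
        exact hmA h0.1
      · rw [← Measure.restrict_apply hN]
        exact hmB h0.2
  have : Nonempty I := ⟨⟨∅, MeasurableSet.empty, 0, inferInstance,
    Measure.AbsolutelyContinuous.zero _, rfl, by
      rw [Measure.restrict_empty]⟩⟩
  refine hC I (fun B => restr B.2.1 X.measurable) X ?_ ?_
  · rintro ⟨B, hB, μ, hμ, h1, h2, h3⟩
    exact hcon B hB μ hμ h1 h2 h3
  · refine ⟨fun B => restr B.2.1.compl X.measurable, ?_, ⟨?_, ?_⟩, ?_⟩
    · intro A B hAB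
      refine restr_le_self _ _ (restr_nonneg _ _ (hXnn.mono fun ω h _ => h)) ?_
      filter_upwards [coeFn_restr (m := qsMeasure 𝔓) A.2.1.compl X.measurable] with ω h1 h2
      rw [h1, Set.indicator_of_mem (show ω ∈ A.1ᶜ from fun h => h2 (hAB h))]
    · rintro _ ⟨A, rfl⟩
      exact restr_nonneg _ _ (hXnn.mono fun ω h _ => h)
    · intro Z hZ
      have hPm : MeasurableSet {ω | 0 < Z ω} := measurableSet_lt measurable_const Z.measurable
      rw [coeFn_nonpos, ae_iff]
      simp only [not_le]
      -- By equivalence it suffices that `{Z > 0}` is null for each `Q ∈ 𝔔`. The support of `Q` is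
      -- itself an index, and the error there vanishes on it.
      refine (isPolar_iff.1 ⟨hPm, heq.2 _ hPm ?_⟩).2
      simp only [ENNReal.iSup_eq_zero]
      intro Q hQ
      have := hprob Q hQ
      obtain ⟨S, hS, hQS, hmS⟩ := isSupported_iff.1 (hsupp Q hQ)
      have hQm := absolutelyContinuous_of_dominatedBy heq.1 hQ
      have hle := hZ ⟨⟨S, hS, Q, inferInstance, hQm, hQS, hmS⟩, rfl⟩
      have hmem : ∀ᵐ ω ∂Q, ω ∈ S := by
        rw [ae_iff]
        exact hQS
      have : ∀ᵐ ω ∂Q, Z ω ≤ 0 := by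
        filter_upwards [hmem, hQm.ae_le (AEEqFun.coeFn_le.2 hle),
          hQm.ae_le (coeFn_restr (m := qsMeasure 𝔓) hS.compl X.measurable)] with ω h1 h2 h3
        rwa [h3, Set.indicator_of_notMem (Set.notMem_compl_iff.2 h1)] at h2
      rw [ae_iff] at this
      simpa only [not_le] using this
    · intro B
      rw [coeFn_abs_sub_le]
      filter_upwards [coeFn_restr (m := qsMeasure 𝔓) B.2.1 X.measurable,
        coeFn_restr (m := qsMeasure 𝔓) B.2.1.compl X.measurable, hXnn] with ω h1 h2 h3
      rw [h1, h2]
      by_cases hω : ω ∈ B.1 <;> simp [hω, abs_of_nonneg h3]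

/-- Shrinking the support to where the density is nonzero restores mutual domination, so the
separating measure remains in `scaC`. -/
theorem isSupported_withDensity {μ : Measure Ω} (hμ : IsSupported 𝔓 μ) {h : Ω → ℝ≥0∞}
    (hh : Measurable h) : IsSupported 𝔓 (μ.withDensity h) := by
  obtain ⟨S, hS, hμS, hmS⟩ := isSupported_iff.1 hμ
  have hPm : MeasurableSet {ω | h ω ≠ 0} := (hh (measurableSet_singleton 0)).compl
  refine isSupported_iff.2 ⟨S ∩ {ω | h ω ≠ 0}, hS.inter hPm, ?_, ?_⟩
  · rw [Set.compl_inter]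
    refine measure_union_null (withDensity_absolutelyContinuous _ _ hμS) ?_
    rw [withDensity_apply_eq_zero hh, Set.inter_compl_self, measure_empty]
  · refine Measure.AbsolutelyContinuous.mk fun N hN h0 => ?_
    rw [withDensity_apply_eq_zero hh] at h0
    have := hmS h0
    rw [Measure.restrict_apply (hPm.inter hN)] at this
    rw [Measure.restrict_apply hN]
    refine measure_mono_null ?_ this
    rintro ω ⟨h1, h2, h3⟩
    exact ⟨⟨h3, h1⟩, h2⟩

theorem bs3_of_bs1 (hS : IsClassS 𝔓) {C : Set (L0 𝔓)} (hne : C.Nonempty)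
    (hpos : ∀ X ∈ C, 0 ≤ X) (hconv : Convex ℝ C) (hsol : IsSolidPos C) (hC : BS1 C) : BS3 C := by
  obtain ⟨𝔔, -, hprob, heq, hsupp⟩ := hS
  refine Set.Subset.antisymm (fun X hX => ⟨hpos X hX, fun μ hμ => hμ.1.2 X hX⟩) ?_
  rintro X ⟨hX, hint⟩
  by_contra hXC
  obtain ⟨S, hS, μ, hμ, hμm, hμS, hmS, hnot⟩ :=
    exists_support_restr_notMem hprob heq hsupp hC hX hXC
  obtain ⟨h, hh, hhi, hle, hlt⟩ :=
    exists_density hS hμm hμS hmS hne hpos hconv hsol hC hX hnot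
  set ν := μ.withDensity fun ω => ENNReal.ofReal (h ω)
  have : IsFiniteMeasure ν := isFiniteMeasure_withDensity_ofReal hhi.2
  have hνm : ν ≪ qsMeasure 𝔓 := (withDensity_absolutelyContinuous _ _).trans hμm
  have hνs : IsSupported 𝔓 ν :=
    isSupported_withDensity (isSupported_iff.2 ⟨S, hS, hμS, hmS⟩) hh.ennreal_ofReal
  have := hint ν.toSignedMeasure
    ⟨(toSignedMeasure_mem_polar_iff hνm).2 hle, toSignedMeasure_mem_scaC hνm hνs⟩
  rw [integ_toSignedMeasure] at this
  exact absurd hlt (not_lt.2 this)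

/-! ### Test sets for the converse directions -/

theorem isSolidPos_singleton_zero : IsSolidPos ({0} : Set (L0 𝔓)) := by
  rintro X rfl Y h0 h1
  exact le_antisymm h1 h0

theorem bs1_singleton_zero : BS1 ({0} : Set (L0 𝔓)) := by
  intro I _ _ _ x a hx hxa
  obtain ⟨y, -, hglb, hxy⟩ := hxa
  have hle : |(0 : L0 𝔓) - a| ≤ 0 := hglb.2 <| by
    rintro _ ⟨i, rfl⟩
    have h1 := hxy i
    have h2 : x i = 0 := hx i
    rwa [h2] at h1
  rw [coeFn_abs_sub_le] at hle
  refine AEEqFun.ext ?_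
  filter_upwards [hle, AEEqFun.coeFn_zero (α := Ω) (μ := qsMeasure 𝔓) (β := ℝ)] with ω h1 h2
  rw [h2] at h1 ⊢
  simpa using h1

/-- The indicator of a nonpolar event lies outside `{0}`, so some supported measure charges the
event. Normalised, these measures show that all supported probabilities dominated by `𝔓` together
are equivalent to `𝔓`. -/
theorem isClassS_of_bs3_singleton_zero (hne : 𝔓.Nonempty)
    (hprob : ∀ P ∈ 𝔓, IsProbabilityMeasure P) (h : BS3 ({0} : Set (L0 𝔓))) : IsClassS 𝔓 := by
  have key : ∀ A, MeasurableSet A → qsMeasure 𝔓 A ≠ 0 → ∃ Q : Measure Ω,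
      IsProbabilityMeasure Q ∧ Q ≪ qsMeasure 𝔓 ∧ IsSupported 𝔓 Q ∧ Q A ≠ 0 := by
    intro A hA hA0
    have hnot : (restr hA (measurable_const (a := (1 : ℝ))) : L0 𝔓) ∉ ({0} : Set (L0 𝔓)) := by
      intro hmem
      have hmem : (restr hA (measurable_const (a := (1 : ℝ))) : L0 𝔓) = 0 := hmem
      have h1 := coeFn_restr (m := qsMeasure 𝔓) hA (measurable_const (a := (1 : ℝ)))
      rw [hmem] at h1
      have : ∀ᵐ ω ∂(qsMeasure 𝔓), ω ∉ A := by
        filter_upwards [h1, AEEqFun.coeFn_zero (α := Ω) (μ := qsMeasure 𝔓) (β := ℝ)]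
          with ω h1 h2 h3
        rw [h2, Set.indicator_of_mem h3] at h1
        simp at h1
      rw [ae_iff] at this
      exact hA0 (by simpa using this)
    rw [h] at hnot
    have hnn : (0 : L0 𝔓) ≤ restr hA (measurable_const (a := (1 : ℝ))) :=
      restr_nonneg _ _ (ae_of_all _ fun _ _ => zero_le_one)
    have hex : ∃ μ ∈ scaC 𝔓, integ (restr hA (measurable_const (a := (1 : ℝ))) : L0 𝔓) μ ≠ 0 := by
      by_contra! hcon
      exact hnot ⟨hnn, fun μ hμ => by rw [hcon μ hμ.2]; exact zero_le_one⟩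
    obtain ⟨μ, hμ, hμA⟩ := hex
    have hμm := dominatedBy_singleton_iff.1 hμ.1
    set ν := μ.totalVariation with hν
    have hνA : ν A ≠ 0 := by
      intro h0
      refine hμA ?_
      have : ∀ᵐ ω ∂ν, ω ∉ A := by
        rw [ae_iff]
        simpa using h0
      rw [integ, ← hν, ← lintegral_zero (μ := ν)]
      refine lintegral_congr_ae ?_
      filter_upwards [this, hμm.ae_le
        (coeFn_restr (m := qsMeasure 𝔓) hA (measurable_const (a := (1 : ℝ))))] with ω h1 h2
      rw [h2, Set.indicator_of_notMem h1, ENNReal.ofReal_zero]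
    have hν0 : ν Set.univ ≠ 0 := fun h0 => hνA (measure_mono_null (Set.subset_univ _) h0)
    have : IsFiniteMeasure ν := by
      rw [hν, SignedMeasure.totalVariation]
      infer_instance
    have : NeZero ν := ⟨fun h0 => hν0 (by rw [h0]; rfl)⟩
    have hc : (ν Set.univ)⁻¹ ≠ 0 := ENNReal.inv_ne_zero.2 (measure_ne_top _ _)
    have hiff : ∀ B, ((ν Set.univ)⁻¹ • ν) B = 0 ↔ ν B = 0 := fun B => by
      rw [Measure.smul_apply, smul_eq_mul, mul_eq_zero]
      exact or_iff_right hc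
    refine ⟨(ν Set.univ)⁻¹ • ν, inferInstance, Measure.AbsolutelyContinuous.mk fun N _ h0 =>
      (hiff N).2 (hμm h0), ?_, fun h0 => hνA ((hiff A).1 h0)⟩
    obtain ⟨S, hS, h1, h2⟩ := hμ.2
    exact ⟨S, hS, (hiff _).2 h1, fun N hN h0 => h2 N hN ((hiff _).1 h0)⟩
  refine ⟨{Q | IsProbabilityMeasure Q ∧ Q ≪ qsMeasure 𝔓 ∧ IsSupported 𝔓 Q}, ?_,
    fun Q hQ => hQ.1, ⟨?_, ?_⟩, fun Q hQ => hQ.2.2⟩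
  · obtain ⟨P, hP⟩ := hne
    have := hprob P hP
    -- Ω is nonpolar since `𝔓` contains a probability measure, so `key` also yields nonemptiness.
    obtain ⟨Q, h1, h2, h3, -⟩ := key Set.univ MeasurableSet.univ fun h0 => by
      have hpol : upperProb 𝔓 Set.univ = 0 := (isPolar_iff.2 ⟨MeasurableSet.univ, h0⟩).2
      simp only [upperProb, ENNReal.iSup_eq_zero] at hpol
      simpa using hpol P hP
    exact ⟨Q, h1, h2, h3⟩
  · intro N hN h0
    simp only [ENNReal.iSup_eq_zero]
    intro Q hQ
    exact hQ.2.1 (isPolar_iff.1 ⟨hN, h0⟩).2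
  · intro N hN h0
    simp only [ENNReal.iSup_eq_zero] at h0
    by_contra hcon
    obtain ⟨Q, h1, h2, h3, h4⟩ := key N hN fun h5 => hcon (isPolar_iff.2 ⟨hN, h5⟩).2
    exact h4 (h0 Q ⟨h1, h2, h3⟩)

/-- The unit sublevel set of the integral of a measure in `ca_c` on the positive cone. -/
def unitSublevel (𝔓 : Set (Measure Ω)) (ν : Measure Ω) : Set (L0 𝔓) :=
  {X | 0 ≤ X ∧ ∫⁻ ω, ENNReal.ofReal (X ω) ∂ν ≤ 1}

theorem unitSublevel_nonempty {ν : Measure Ω} (hν : ν ≪ qsMeasure 𝔓) :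
    (unitSublevel 𝔓 ν).Nonempty := by
  refine ⟨0, le_rfl, ?_⟩
  have : ∫⁻ ω, ENNReal.ofReal ((0 : L0 𝔓) ω) ∂ν = ∫⁻ _, 0 ∂ν := by
    refine lintegral_congr_ae ?_
    filter_upwards [hν.ae_le (AEEqFun.coeFn_zero (α := Ω) (μ := qsMeasure 𝔓) (β := ℝ))] with ω h
    rw [h]
    simp
  rw [this]
  simp

theorem convex_unitSublevel {ν : Measure Ω} (hν : ν ≪ qsMeasure 𝔓) :
    Convex ℝ (unitSublevel 𝔓 ν) := by
  rintro X ⟨hX, hXi⟩ Y ⟨hY, hYi⟩ a b ha hb hab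
  have heq : ∀ᵐ ω ∂(qsMeasure 𝔓), (a • X + b • Y : L0 𝔓) ω = a * X ω + b * Y ω := by
    filter_upwards [AEEqFun.coeFn_add (a • X) (b • Y), AEEqFun.coeFn_smul a X,
      AEEqFun.coeFn_smul b Y] with ω h1 h2 h3
    rw [h1, Pi.add_apply, h2, h3]
    rfl
  refine ⟨?_, ?_⟩
  · rw [coeFn_nonneg]
    filter_upwards [heq, coeFn_nonneg.1 hX, coeFn_nonneg.1 hY] with ω h1 h2 h3
    rw [h1]
    positivity
  · have : ∫⁻ ω, ENNReal.ofReal ((a • X + b • Y : L0 𝔓) ω) ∂ν =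
        ∫⁻ ω, ENNReal.ofReal a * ENNReal.ofReal (X ω) + ENNReal.ofReal b * ENNReal.ofReal (Y ω) ∂ν := by
      refine lintegral_congr_ae ?_
      filter_upwards [hν.ae_le heq, hν.ae_le (coeFn_nonneg.1 hX), hν.ae_le (coeFn_nonneg.1 hY)]
        with ω h1 h2 h3
      rw [h1, ENNReal.ofReal_add (mul_nonneg ha h2) (mul_nonneg hb h3), ENNReal.ofReal_mul ha,
        ENNReal.ofReal_mul hb]
    rw [this, lintegral_add_left (X.measurable.ennreal_ofReal.const_mul _),
      lintegral_const_mul _ X.measurable.ennreal_ofReal,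
      lintegral_const_mul _ Y.measurable.ennreal_ofReal]
    calc ENNReal.ofReal a * ∫⁻ ω, ENNReal.ofReal (X ω) ∂ν +
          ENNReal.ofReal b * ∫⁻ ω, ENNReal.ofReal (Y ω) ∂ν
        ≤ ENNReal.ofReal a * 1 + ENNReal.ofReal b * 1 := by gcongr
      _ = 1 := by rw [mul_one, mul_one, ← ENNReal.ofReal_add ha hb, hab, ENNReal.ofReal_one]

theorem isSolidPos_unitSublevel {ν : Measure Ω} (hν : ν ≪ qsMeasure 𝔓) :
    IsSolidPos (unitSublevel 𝔓 ν) := by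
  rintro X ⟨-, hXi⟩ Y hY hYX
  refine ⟨hY, (lintegral_mono_ae ?_).trans hXi⟩
  filter_upwards [hν.ae_le (AEEqFun.coeFn_le.2 hYX)] with ω h
  exact ENNReal.ofReal_le_ofReal h

/-- The measure `ν` belongs to the polar of its own sublevel set, so the bipolar cannot be larger.
-/
theorem bs2_unitSublevel {ν : Measure Ω} [IsFiniteMeasure ν] (hν : ν ≪ qsMeasure 𝔓) :
    BS2 (unitSublevel 𝔓 ν) := by
  refine Set.Subset.antisymm (fun X hX => ⟨hX.1, fun μ hμ => hμ.2 X hX⟩) ?_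
  rintro X ⟨hX, hint⟩
  refine ⟨hX, ?_⟩
  rw [← integ_toSignedMeasure]
  exact hint _ ((toSignedMeasure_mem_polar_iff hν).2 fun Y hY => hY.2)

theorem bs2_iff_bs3_of_scaC_eq_caC (h : scaC 𝔓 = caC 𝔓) (C : Set (L0 𝔓)) : BS2 C ↔ BS3 C := by
  have : polar C ∩ scaC 𝔓 = polar C := by
    rw [h]
    exact Set.inter_eq_left.2 fun μ hμ => hμ.1.1
  rw [BS2, BS3, this]

/-- Each `P ∈ 𝔓` lies in `caC 𝔓`, so `𝔓` itself serves as the equivalent set of supported measures.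
-/
theorem isClassS_of_scaC_eq_caC (hne : 𝔓.Nonempty) (hprob : ∀ P ∈ 𝔓, IsProbabilityMeasure P)
    (h : scaC 𝔓 = caC 𝔓) : IsClassS 𝔓 := by
  refine ⟨𝔓, hne, hprob, ⟨fun _ _ h => h, fun _ _ h => h⟩, fun P hP => ?_⟩
  have := hprob P hP
  have hPm : P ≪ qsMeasure 𝔓 := absolutelyContinuous_of_dominatedBy (fun _ _ h => h) hP
  have : P.toSignedMeasure ∈ scaC 𝔓 := h ▸ (toSignedMeasure_mem_caCPos hPm).1
  simpa only [totalVariation_toSignedMeasure] using this.2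

end Translation

end RobustBS

theorem theorem4p1 {Ω : Type u} [MeasurableSpace Ω] (𝔓 : Set (Measure Ω))
    (h𝔓 : 𝔓.Nonempty) (hprob : ∀ P ∈ 𝔓, IsProbabilityMeasure P) :
    (RobustBS.IsClassS 𝔓 ↔
      ∀ C : Set (RobustBS.L0 𝔓), C.Nonempty → (∀ X ∈ C, 0 ≤ X) → Convex ℝ C →
        RobustBS.IsSolidPos C → (RobustBS.BS1 C ↔ RobustBS.BS3 C)) ∧
    (RobustBS.scaC 𝔓 = RobustBS.caC 𝔓 ↔
      ∀ C : Set (RobustBS.L0 𝔓), C.Nonempty → (∀ X ∈ C, 0 ≤ X) → Convex ℝ C →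
        RobustBS.IsSolidPos C → (RobustBS.BS1 C ↔ RobustBS.BS2 C)) := by
  refine ⟨⟨fun hS C hne hpos hconv hsol =>
    ⟨RobustBS.bs3_of_bs1 hS hne hpos hconv hsol, RobustBS.bs1_of_bs3⟩, fun h => ?_⟩,
    ⟨fun hS C hne hpos hconv hsol => ?_, fun h => ?_⟩⟩
  · refine RobustBS.isClassS_of_bs3_singleton_zero h𝔓 hprob ((h {0} (Set.singleton_nonempty 0) ?_
      (convex_singleton 0) RobustBS.isSolidPos_singleton_zero).1 RobustBS.bs1_singleton_zero)
    rintro X rfl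
    exact le_rfl
  · rw [RobustBS.bs2_iff_bs3_of_scaC_eq_caC hS]
    exact ⟨RobustBS.bs3_of_bs1 (RobustBS.isClassS_of_scaC_eq_caC h𝔓 hprob hS) hne hpos hconv hsol,
      RobustBS.bs1_of_bs3⟩
  · refine Set.Subset.antisymm (fun μ hμ => hμ.1) fun μ hμ => ⟨hμ, ?_⟩
    have hν := RobustBS.dominatedBy_singleton_iff.1 hμ
    have : IsFiniteMeasure μ.totalVariation := by
      rw [SignedMeasure.totalVariation]
      infer_instance
    rw [RobustBS.isSupported_iff]
    exact RobustBS.exists_support_of_isOrderClosed hν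
      ((h _ (RobustBS.unitSublevel_nonempty hν) (fun X hX => hX.1) (RobustBS.convex_unitSublevel hν)
        (RobustBS.isSolidPos_unitSublevel hν)).2 (RobustBS.bs2_unitSublevel hν))
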